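/- Let $m,n\ge 1$ be integers. For each $d\ge 1$ let $G=G_d$ be a random $dn\times dm$ matrix with i.i.d. standard complex Gaussian $\mathcal N(0,1)$ entries (so that $\mathbb E|G_{ij}|^2=1$), let $W=(dm)^{-1}GG^*\in M_d(\mathbb C)\otimes M_n(\mathbb C)$ be the complex Wishart matrix of parameters $(dn,dm)$, and let $W^\Gamma=(\mathrm{id}\otimes\mathrm t)W$ be its partial transposition, i.e. $W^\Gamma_{ia,jb}=W_{ib,ja}$ for $1\le i,j\le d$ and $1\le a,b\le n$. Write $\mathrm{tr}=(dn)^{-1}\mathrm{Tr}$ for the normalized trace on $M_{dn}(\mathbb C)$. Then for every $p\ge 0$ the limiting moment $$M_p=\lim_{d\to\infty}\mathbb E\,\mathrm{tr}\big((mW^\Gamma)^p\big)$$ exists and is a real number, and the moment generating function $F(z)=\sum_{p\ge 0}M_pz^p$ satisfies the equation $$(F-1)(1-z^2F^2)=mzF(1+nzF),$$ both as an identity of formal power series and, for every complex $z$ with $|z|<(4mn)^{-1}$ (where the series converges), as an identity of complex numbers. -/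

import Mathlib

open MeasureTheory ProbabilityTheory Filter Topology
open scoped Matrix ENNReal NNReal

namespace BlockWishart

/-- The standard complex Gaussian law `N(0,1)` on `ℂ`: the real and imaginary parts are independent
centered real Gaussians of variance `1/2`, so that `E|g|² = 1` and `E g² = 0`. -/
noncomputable def stdComplexGaussian : Measure ℂ :=
  ((gaussianReal 0 (1 / 2)).prod (gaussianReal 0 (1 / 2))).map
    (fun x : ℝ × ℝ => (⟨x.1, x.2⟩ : ℂ))

/-- The random matrix `G`, defined on the probability space `(Ω, P)`, has independent entries,
each of which has the standard complex Gaussian law. -/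
structure HasIIDGaussianEntries {Ω ι κ : Type*} [MeasurableSpace Ω] (P : Measure Ω)
    (G : Ω → Matrix ι κ ℂ) : Prop where
  law : ∀ i k, HasLaw (fun ω => G ω i k) stdComplexGaussian P
  indep : iIndepFun (fun (e : ι × κ) (ω : Ω) => G ω e.1 e.2) P

/-- The complex Wishart matrix `W = (dm)⁻¹ G G*` of parameters `(dn, dm)` built from the
`dn × dm` matrix `G`. The `dn` rows are indexed by pairs (block index, index inside the block),
and the `dm` columns by pairs as well. -/
noncomputable def wishart {d n m : ℕ} (G : Matrix (Fin d × Fin n) (Fin d × Fin m) ℂ) :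
    Matrix (Fin d × Fin n) (Fin d × Fin n) ℂ :=
  ((d : ℂ) * (m : ℂ))⁻¹ • (G * Gᴴ)

/-- The partial transposition `W^Γ = (id ⊗ t) W`: each of the `n × n` blocks is transposed. -/
def partialTranspose {d n : ℕ} (W : Matrix (Fin d × Fin n) (Fin d × Fin n) ℂ) :
    Matrix (Fin d × Fin n) (Fin d × Fin n) ℂ :=
  Matrix.of fun x y => W (x.1, y.2) (y.1, x.2)

/-- The normalized trace on `M_{dn}(ℂ)`. -/
noncomputable def normalizedTrace {d n : ℕ} (A : Matrix (Fin d × Fin n) (Fin d × Fin n) ℂ) : ℂ :=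
  ((d : ℂ) * (n : ℂ))⁻¹ * A.trace

/-- The random variable `tr ((m W^Γ)^p)`, as a function of the Gaussian matrix `G`. -/
noncomputable def traceMoment {d n m : ℕ} (p : ℕ)
    (G : Matrix (Fin d × Fin n) (Fin d × Fin m) ℂ) : ℂ :=
  normalizedTrace (((m : ℂ) • partialTranspose (wishart G)) ^ p)

end BlockWishart

/-! With blocks of `G` normalized by d^{-1/2}, the (a, b) block of m W^Γ is ∑_c G_{bc} G_{ac}^*, so
E tr((mW^Γ)^p) is a finite sum of expected traces of words in the d × d blocks and their adjoints.
Integration by parts in the first letter of a word (`expectation_X_mul`) gives a loop equation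
(`expectation_traceProd_cons`): a pairing inside the same trace splits it in two, while a pairing
with another trace costs d^{-2}. Hence products of traces factorize in the limit, and each trace
tends to a number of noncrossing pairings, `freeMoment` (`tendsto_expectation_traceProd`).

Summed over the words of a power, the same first-letter recursion relates the limits of the blocks
to those of the sandwiched words enclosed by the first pairing. All these arrays turn out to be
scalar in the block indices, leaving two sequences M and N (`exists_moment_sequences`). The system
closes because a contracted sandwich of order q is again a block moment, of order q + 1. For the
generating series F of M and H of N it reads F - 1 = z(mF + zHF) and H = nmF + F(F - 1); eliminating
H is `powerSeries_equation`. Comparison with the Catalan recurrence (`moment_le_catalan`) gives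
convergence for |z| < (4mn)^{-1}. -/

namespace BlockWishart

open Finset.HasAntidiagonal (antidiagonal)

/-! ### Splitting words at a letter -/

section Words

variable {L M : Type*} [DecidableEq L] [AddCommMonoid M]

/-- The decompositions `w = u ++ y :: v` of a word around an occurrence of the letter `y`. -/
def splits (y : L) : List L → List (List L × List L)
  | [] => []
  | z :: w => (if z = y then [([], w)] else []) ++ (splits y w).map fun p => (z :: p.1, p.2)

theorem length_of_mem_splits {y : L} {w : List L} {p : List L × List L} (hp : p ∈ splits y w) :
    p.1.length + p.2.length + 1 = w.length := by
  induction w generalizing p with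
  | nil => simp [splits] at hp
  | cons z w ih =>
    simp only [splits, List.mem_append, List.mem_map] at hp
    rcases hp with hp | ⟨q, hq, rfl⟩
    · split_ifs at hp
      · simp only [List.mem_singleton] at hp
        simp [hp]
      · simp at hp
    · have := ih hq
      simp only [List.length_cons]
      omega

/-- The sum of `h u v` over all decompositions `w = u ++ y :: v`. -/
def sumSplits (y : L) (w : List L) (h : List L → List L → M) : M :=
  ((splits y w).map fun p => h p.1 p.2).sum

@[simp]
theorem sumSplits_nil (y : L) (h : List L → List L → M) : sumSplits y [] h = 0 := rfl

theorem sumSplits_cons (y z : L) (w : List L) (h : List L → List L → M) :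
    sumSplits y (z :: w) h =
      (if z = y then h [] w else 0) + sumSplits y w fun u v => h (z :: u) v := by
  simp only [sumSplits, splits, List.map_append, List.map_map, List.sum_append]
  congr 1
  split_ifs <;> simp

theorem sumSplits_concat (y z : L) (w : List L) (h : List L → List L → M) :
    sumSplits y (w ++ [z]) h =
      (if z = y then h w [] else 0) + sumSplits y w fun u v => h u (v ++ [z]) := by
  induction w generalizing h with
  | nil => simp [sumSplits_cons]
  | cons x w ih =>
    rw [List.cons_append, sumSplits_cons, sumSplits_cons, ih]
    abel

theorem sumSplits_map {M' F : Type*} [AddCommMonoid M'] [FunLike F M M'] [AddMonoidHomClass F M M']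
    (φ : F) (y : L) (w : List L) (h : List L → List L → M) :
    φ (sumSplits y w h) = sumSplits y w fun u v => φ (h u v) := by
  simp [sumSplits, map_list_sum, Function.comp_def]

theorem sumSplits_mul_left {R : Type*} [Semiring R] (r : R) (y : L) (w : List L)
    (h : List L → List L → R) : r * sumSplits y w h = sumSplits y w fun u v => r * h u v :=
  sumSplits_map (AddMonoidHom.mulLeft r) y w h

theorem sumSplits_mul_right {R : Type*} [Semiring R] (r : R) (y : L) (w : List L)
    (h : List L → List L → R) : sumSplits y w h * r = sumSplits y w fun u v => h u v * r :=
  sumSplits_map (AddMonoidHom.mulRight r) y w h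

theorem sum_sumSplits {ι : Type*} (t : Finset ι) (y : L) (w : List L)
    (h : ι → List L → List L → M) :
    ∑ i ∈ t, sumSplits y w (h i) = sumSplits y w fun u v => ∑ i ∈ t, h i u v := by
  induction w generalizing h with
  | nil => simp
  | cons z w ih =>
    simp only [sumSplits_cons, Finset.sum_add_distrib, ih]
    congr 1
    split_ifs <;> simp

end Words

/-! ### Noncrossing pairings -/

section FreeMoment

variable {E : Type*} [DecidableEq E]

/-- The letter of the adjoint matrix. -/
def adj (x : E × Bool) : E × Bool := (x.1, !x.2)

/-- The joint moments of a free family of circular elements: the number of noncrossing pairings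
of a word that match each letter with an occurrence of its adjoint. -/
def freeMoment : List (E × Bool) → ℕ
  | [] => 1
  | x :: w => ((splits (adj x) w).attach.map fun p => freeMoment p.1.1 * freeMoment p.1.2).sum
termination_by w => w.length
decreasing_by
  all_goals
    have := length_of_mem_splits p.2
    simp only [List.length_cons]
    omega

@[simp]
theorem freeMoment_nil : freeMoment ([] : List (E × Bool)) = 1 := by
  rw [freeMoment]

theorem freeMoment_cons (x : E × Bool) (w : List (E × Bool)) :
    freeMoment (x :: w) = sumSplits (adj x) w fun u v => freeMoment u * freeMoment v := by
  rw [freeMoment, sumSplits]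
  congr 1
  exact List.attach_map_val (f := fun p => freeMoment p.1 * freeMoment p.2) (l := splits (adj x) w)

end FreeMoment

/-! ### Words in the blocks of a power -/

section BlockSum

variable {n m : ℕ} {M : Type*} [AddCommMonoid M]

/-- Letters: `((a, c), false)` stands for the block `G_{ac}` and `((a, c), true)` for its
adjoint. -/
abbrev Letter (n m : ℕ) : Type := (Fin n × Fin m) × Bool

/-- The sum of `f w` over the words `w` in the expansion of the `(a, b)` block of the `p`-th power
of the matrix with blocks `X_{ab} = ∑ c, G_{bc} G_{ac}^*`. -/
def blockSum : ℕ → Fin n → Fin n → (List (Letter n m) → M) → M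
  | 0, a, b, f => if a = b then f [] else 0
  | p + 1, a, b, f =>
    ∑ e, ∑ c, blockSum p e b fun w => f (((e, c), false) :: ((a, c), true) :: w)

theorem blockSum_zero_left (a b : Fin n) (f : List (Letter n m) → M) :
    blockSum 0 a b f = if a = b then f [] else 0 := rfl

theorem blockSum_succ (p : ℕ) (a b : Fin n) (f : List (Letter n m) → M) :
    blockSum (p + 1) a b f =
      ∑ e, ∑ c, blockSum p e b fun w => f (((e, c), false) :: ((a, c), true) :: w) := rfl

theorem blockSum_map {M' F : Type*} [AddCommMonoid M'] [FunLike F M M'] [AddMonoidHomClass F M M']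
    (φ : F) (p : ℕ) (a b : Fin n) (f : List (Letter n m) → M) :
    blockSum p a b (fun w => φ (f w)) = φ (blockSum p a b f) := by
  induction p generalizing a f with
  | zero => simp only [blockSum_zero_left]; split_ifs <;> simp
  | succ p ih => simp only [blockSum_succ, map_sum, ← ih]

theorem blockSum_add (p : ℕ) (a b : Fin n) (f g : List (Letter n m) → M) :
    blockSum p a b (fun w => f w + g w) = blockSum p a b f + blockSum p a b g := by
  induction p generalizing a f g with
  | zero => simp only [blockSum_zero_left]; split_ifs <;> simp
  | succ p ih => simp only [blockSum_succ, ih, Finset.sum_add_distrib]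

theorem blockSum_zero (p : ℕ) (a b : Fin n) :
    blockSum p a b (fun _ : List (Letter n m) => (0 : M)) = 0 := by
  induction p generalizing a with
  | zero => simp [blockSum_zero_left]
  | succ p ih => simp [blockSum_succ, ih]

theorem blockSum_sum {ι : Type*} (t : Finset ι) (p : ℕ) (a b : Fin n)
    (f : ι → List (Letter n m) → M) :
    blockSum p a b (fun w => ∑ i ∈ t, f i w) = ∑ i ∈ t, blockSum p a b (f i) := by
  classical
  induction t using Finset.induction_on with
  | empty => simp [blockSum_zero]
  | insert i t hi ih => simp [Finset.sum_insert hi, blockSum_add, ih]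

theorem blockSum_const_mul {R : Type*} [Semiring R] (r : R) (p : ℕ) (a b : Fin n)
    (f : List (Letter n m) → R) :
    blockSum p a b (fun w => r * f w) = r * blockSum p a b f :=
  blockSum_map (AddMonoidHom.mulLeft r) p a b f

theorem blockSum_mul_const {R : Type*} [Semiring R] (r : R) (p : ℕ) (a b : Fin n)
    (f : List (Letter n m) → R) :
    blockSum p a b (fun w => f w * r) = blockSum p a b f * r :=
  blockSum_map (AddMonoidHom.mulRight r) p a b f

theorem blockSum_ite (q : Prop) [Decidable q] (p : ℕ) (a b : Fin n) (f : List (Letter n m) → M) :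
    blockSum p a b (fun w => if q then f w else 0) = if q then blockSum p a b f else 0 := by
  split_ifs
  · rfl
  · exact blockSum_zero p a b

theorem tendsto_blockSum {ι : Type*} {l : Filter ι} [TopologicalSpace M] [ContinuousAdd M]
    {f : ι → List (Letter n m) → M} {g : List (Letter n m) → M}
    (h : ∀ w, Tendsto (fun i => f i w) l (𝓝 (g w))) (p : ℕ) (a b : Fin n) :
    Tendsto (fun i => blockSum p a b (f i)) l (𝓝 (blockSum p a b g)) := by
  induction p generalizing a f g with
  | zero =>
    simp only [blockSum_zero_left]
    split_ifs
    exacts [h [], tendsto_const_nhds]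
  | succ p ih =>
    simp only [blockSum_succ]
    exact tendsto_finsetSum _ fun e _ => tendsto_finsetSum _ fun c _ => ih (fun w => h _) e

/-- Splitting the words of a power at the adjoint of a block. -/
theorem blockSum_sumSplits_true (p : ℕ) (a b β : Fin n) (γ : Fin m)
    (h : List (Letter n m) → List (Letter n m) → M) :
    blockSum (p + 1) a b (fun w => sumSplits ((β, γ), true) w h) =
      ∑ q ∈ antidiagonal p, ∑ v, blockSum q.1 a β fun u =>
        blockSum q.2 v b fun w => h (u ++ [((v, γ), false)]) w := by
  induction p generalizing a h with
  | zero =>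
    simp only [blockSum_succ, sumSplits_cons, blockSum_zero_left, Prod.mk.injEq, Bool.false_eq_true,
      and_false, if_false, and_true, sumSplits_nil, add_zero, zero_add, Finset.Nat.antidiagonal_zero,
      Finset.sum_singleton]
    by_cases hab : a = β <;> simp [hab]
  | succ p ih =>
    rw [blockSum_succ]
    simp only [sumSplits_cons, Prod.mk.injEq, Bool.false_eq_true,
      and_false, if_false, and_true, zero_add, blockSum_add, ih, Finset.sum_add_distrib,
      Finset.Nat.sum_antidiagonal_succ, blockSum_ite]
    congr 1
    · by_cases hab : a = β <;> simp [hab, blockSum_zero_left]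
    · simp only [blockSum_succ, List.cons_append]
      simp_rw [Finset.sum_comm (s := (Finset.univ : Finset (Fin m))) (t := antidiagonal p),
        Finset.sum_comm (s := (Finset.univ : Finset (Fin n))) (t := antidiagonal p)]
      refine Finset.sum_congr rfl fun q _ => ?_
      simp_rw [Finset.sum_comm (s := (Finset.univ : Finset (Fin m)))
        (t := (Finset.univ : Finset (Fin n)))]
      rw [Finset.sum_comm]

/-- Splitting the words of a power at a block. -/
theorem blockSum_sumSplits_false (p : ℕ) (a b β : Fin n) (γ : Fin m)
    (h : List (Letter n m) → List (Letter n m) → M) :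
    blockSum (p + 1) a b (fun w => sumSplits ((β, γ), false) w h) =
      ∑ q ∈ antidiagonal p, ∑ s, blockSum q.1 a s fun u =>
        blockSum q.2 β b fun w => h u (((s, γ), true) :: w) := by
  induction p generalizing a h with
  | zero =>
    simp only [blockSum_succ, sumSplits_cons, blockSum_zero_left, Prod.mk.injEq, Bool.true_eq_false,
      and_false, if_false, and_true, sumSplits_nil, add_zero, Finset.Nat.antidiagonal_zero,
      Finset.sum_singleton]
    simp only [Finset.sum_ite_eq, ite_and, Finset.mem_univ, if_true]
    rw [Finset.sum_comm]
    by_cases hab : b = β <;> simp [hab, eq_comm]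
  | succ p ih =>
    rw [blockSum_succ]
    simp only [sumSplits_cons, Prod.mk.injEq, Bool.true_eq_false,
      and_false, if_false, and_true, zero_add, blockSum_add, ih, Finset.sum_add_distrib,
      Finset.Nat.sum_antidiagonal_succ, blockSum_ite]
    congr 1
    · simp [blockSum_zero_left, ite_and]
    · simp only [blockSum_succ]
      simp_rw [Finset.sum_comm (s := (Finset.univ : Finset (Fin m))) (t := antidiagonal p),
        Finset.sum_comm (s := (Finset.univ : Finset (Fin n))) (t := antidiagonal p)]
      refine Finset.sum_congr rfl fun q _ => ?_
      simp_rw [Finset.sum_comm (s := (Finset.univ : Finset (Fin m)))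
        (t := (Finset.univ : Finset (Fin n)))]
      rw [Finset.sum_comm]

end BlockSum
-- Recursions for the limiting moments
section LimitMoments

variable {n m : ℕ}

/-- The limit of the normalized trace of the `(a, b)` block of `(m W^Γ)^p`. -/
def blockMoment (m p : ℕ) (a b : Fin n) : ℕ :=
  blockSum p a b (freeMoment (E := Fin n × Fin m))

/-- The limit of `∑ c, tr (G_{sc}^* (X^p)_{ab} G_{vc})`. -/
def outerMoment (m p : ℕ) (a b s v : Fin n) : ℕ :=
  ∑ c : Fin m, blockSum p a b fun u =>
    freeMoment (((s, c), true) :: (u ++ [((v, c), false)]))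

/-- The limit of `∑ e c, tr (G_{ac}^* (X^p)_{ee} G_{vc})`. -/
def innerMoment (m p : ℕ) (a v : Fin n) : ℕ := ∑ e, outerMoment m p e e a v

/-- The opening adjoint letter pairs either with the closing letter, enclosing all of `w`, or with a
letter of `w`. -/
theorem freeMoment_sandwich (s v : Fin n) (c : Fin m) (w : List (Letter n m)) :
    freeMoment (((s, c), true) :: (w ++ [((v, c), false)])) =
      (if v = s then freeMoment w else 0) +
        sumSplits ((s, c), false) w fun u u' =>
          freeMoment u * freeMoment (u' ++ [((v, c), false)]) := by
  rw [freeMoment_cons]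
  simp [adj, sumSplits_concat]

theorem blockMoment_zero (a b : Fin n) : blockMoment m 0 a b = if a = b then 1 else 0 := by
  simp [blockMoment, blockSum_zero_left]

theorem blockMoment_succ_aux (p : ℕ) (a b : Fin n) :
    blockMoment m (p + 1) a b = m * blockMoment m p a b +
      ∑ e : Fin n, ∑ c : Fin m, blockSum p e b fun w =>
        sumSplits ((e, c), true) w fun u v => freeMoment (((a, c), true) :: u) * freeMoment v := by
  simp only [blockMoment, blockSum_succ, freeMoment_cons (((_, _), false) : Letter n m),
    sumSplits_cons, adj, Bool.not_false, Prod.mk.injEq, and_true, freeMoment_nil, one_mul,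
    blockSum_add, blockSum_ite, Finset.sum_add_distrib]
  congr 1
  simp

theorem blockMoment_one (a b : Fin n) : blockMoment m 1 a b = m * blockMoment m 0 a b := by
  rw [blockMoment_succ_aux]
  simp [blockSum_zero_left]

/-- The first letter G_{ec} pairs with the adjacent G_{ac}^*, forcing e = a with `m` choices of c,
or with a later G_{ec}^*. In the second case the enclosed word runs over G_{ac}^* (X^q)_{ee} G_{vc},
whose sum over e and c is `innerMoment`. -/
theorem blockMoment_succ_succ (p : ℕ) (a b : Fin n) :
    blockMoment m (p + 2) a b = m * blockMoment m (p + 1) a b +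
      ∑ q ∈ antidiagonal p, ∑ v, innerMoment m q.1 a v * blockMoment m q.2 v b := by
  rw [blockMoment_succ_aux]
  congr 1
  simp only [blockSum_sumSplits_true, blockSum_const_mul, blockSum_mul_const, innerMoment,
    outerMoment, blockMoment, Finset.sum_mul]
  simp_rw [Finset.sum_comm (s := (Finset.univ : Finset (Fin m))) (t := antidiagonal p),
    Finset.sum_comm (s := (Finset.univ : Finset (Fin n))) (t := antidiagonal p)]
  refine Finset.sum_congr rfl fun q _ => ?_
  simp_rw [Finset.sum_comm (s := (Finset.univ : Finset (Fin m)))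
    (t := (Finset.univ : Finset (Fin n)))]
  rw [Finset.sum_comm]

theorem outerMoment_zero (a b s v : Fin n) :
    outerMoment m 0 a b s v = if v = s then m * blockMoment m 0 a b else 0 := by
  by_cases h : v = s <;> by_cases h' : a = b <;>
  simp [outerMoment, blockSum_zero_left, freeMoment_cons, sumSplits_cons, adj, blockMoment, h, h']

/-- If G_{sc}^* pairs inside the power, what remains after that pairing starts with some G_{tc}^*
and ends with G_{vc}: again a sandwich, in which `s` has become a block index. -/
theorem outerMoment_succ (p : ℕ) (a b s v : Fin n) :
    outerMoment m (p + 1) a b s v = (if v = s then m * blockMoment m (p + 1) a b else 0) +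
      ∑ q ∈ antidiagonal p, ∑ t, blockMoment m q.1 a t * outerMoment m q.2 s b t v := by
  have : outerMoment m (p + 1) a b s v = ∑ c : Fin m, blockSum (p + 1) a b fun w =>
      (if v = s then freeMoment w else 0) + sumSplits ((s, c), false) w fun u u' =>
        freeMoment u * freeMoment (u' ++ [((v, c), false)]) := by
    simp only [outerMoment, freeMoment_sandwich]
  rw [this]
  simp only [blockSum_add, blockSum_ite, Finset.sum_add_distrib, blockSum_sumSplits_false,
    List.cons_append, blockSum_const_mul, blockSum_mul_const]
  simp only [outerMoment, blockMoment, Finset.mul_sum]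
  congr 1
  · simp
  · rw [Finset.sum_comm]
    exact Finset.sum_congr rfl fun q _ => Finset.sum_comm

theorem innerMoment_zero (a v : Fin n) :
    innerMoment m 0 a v = if v = a then n * m else 0 := by
  simp [innerMoment, outerMoment_zero, blockMoment_zero]

theorem innerMoment_succ (p : ℕ) (a v : Fin n) :
    innerMoment m (p + 1) a v = (if v = a then m * ∑ e : Fin n, blockMoment m (p + 1) e e else 0) +
      ∑ q ∈ antidiagonal p, ∑ e, ∑ t, blockMoment m q.1 e t * outerMoment m q.2 a e t v := by
  simp only [innerMoment, outerMoment_succ, Finset.sum_add_distrib]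
  rw [Finset.sum_comm (t := antidiagonal p)]
  congr 1
  split_ifs <;> simp [Finset.mul_sum, *]

theorem sum_outerMoment_zero (a v : Fin n) :
    ∑ e, outerMoment m 0 a e e v = m * blockMoment m 0 a v := by
  simp [outerMoment_zero]

/-- Contracting b = s turns the remaining sandwich into an `innerMoment`. The recursion is then that
of `blockMoment_succ_succ` with the two factors in the opposite order. -/
theorem sum_outerMoment_succ (p : ℕ) (a v : Fin n) :
    ∑ e, outerMoment m (p + 1) a e e v = m * blockMoment m (p + 1) a v +
      ∑ q ∈ antidiagonal p, ∑ t, blockMoment m q.1 a t * innerMoment m q.2 t v := by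
  simp only [innerMoment, outerMoment_succ, Finset.sum_add_distrib, Finset.mul_sum]
  rw [Finset.sum_comm (t := antidiagonal p)]
  congr 1
  · simp
  · exact Finset.sum_congr rfl fun q _ => Finset.sum_comm

/-- The moments `blockMoment` and `innerMoment` are scalar matrices, and hence satisfy scalar
recursions. -/
theorem exists_moment_sequences (m : ℕ) (hn : 1 ≤ n) :
    ∃ M N : ℕ → ℕ, (∀ p (a b : Fin n), blockMoment m p a b = if a = b then M p else 0) ∧
      M 0 = 1 ∧ M 1 = m ∧
      (∀ p, M (p + 2) = m * M (p + 1) + ∑ q ∈ antidiagonal p, N q.1 * M q.2) ∧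
      N 0 = n * m ∧
      ∀ p, N (p + 1) = n * m * M (p + 1) + ∑ q ∈ antidiagonal p, M q.1 * M (q.2 + 1) := by
  let o : Fin n := ⟨0, hn⟩
  obtain ⟨M, hM⟩ : ∃ M : ℕ → ℕ, ∀ p, M p = blockMoment m p o o := ⟨_, fun _ => rfl⟩
  obtain ⟨N, hN⟩ : ∃ N : ℕ → ℕ, ∀ p, N p = innerMoment m p o o := ⟨_, fun _ => rfl⟩
  -- Scalar matrices commute, so the order of the factors no longer matters and the contracted
  -- sandwich is the block moment of the next order. This closes the system.
  have outer : ∀ l, (∀ q ≤ l + 1, ∀ a b : Fin n, blockMoment m q a b = if a = b then M q else 0) →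
      (∀ q ≤ l, ∀ a b : Fin n, innerMoment m q a b = if a = b then N q else 0) →
      ∀ a v : Fin n, ∑ e, outerMoment m l a e e v = if a = v then M (l + 1) else 0 := by
    intro l hT hR a v
    rw [← hT (l + 1) le_rfl a v]
    cases l with
    | zero => rw [sum_outerMoment_zero, blockMoment_one]
    | succ l =>
      rw [sum_outerMoment_succ, blockMoment_succ_succ, ← Finset.Nat.sum_antidiagonal_swap]
      congr 1
      refine Finset.sum_congr rfl fun q hq => ?_
      have hq := Finset.HasAntidiagonal.mem_antidiagonal.1 hq
      simp [hT q.2 (by omega), hR q.1 (by omega), mul_comm]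
  have inner : ∀ p, (∀ q ≤ p + 1, ∀ a b : Fin n, blockMoment m q a b = if a = b then M q else 0) →
      (∀ q ≤ p, ∀ a b : Fin n, innerMoment m q a b = if a = b then N q else 0) →
      ∀ a v : Fin n, innerMoment m (p + 1) a v = if a = v then
        n * m * M (p + 1) + ∑ q ∈ antidiagonal p, M q.1 * M (q.2 + 1) else 0 := by
    intro p hT hR a v
    have : ∀ q ∈ antidiagonal p, ∑ e, ∑ t, blockMoment m q.1 e t * outerMoment m q.2 a e t v =
        if a = v then M q.1 * M (q.2 + 1) else 0 := by
      intro q hq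
      have hq := Finset.HasAntidiagonal.mem_antidiagonal.1 hq
      have := outer q.2 (fun r hr => hT r (by omega)) (fun r hr => hR r (by omega)) a v
      simp [hT q.1 (by omega), ← Finset.mul_sum, this]
    rw [innerMoment_succ, Finset.sum_congr rfl this]
    by_cases h : a = v
    · simp [h, hT (p + 1) le_rfl]
      ring
    · simp [h, Ne.symm h]
  have key : ∀ p, (∀ a b : Fin n, blockMoment m p a b = if a = b then M p else 0) ∧
      (∀ a b : Fin n, innerMoment m p a b = if a = b then N p else 0) := by
    intro p
    induction p using Nat.strong_induction_on with
    | _ p ih =>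
      -- The block moment of order p uses only smaller orders, whereas the inner moment of order p
      -- uses the block moment of order p; hence this one is settled first.
      have scal : ∀ a b : Fin n, blockMoment m p a b = if a = b then M p else 0 := by
        have aux : ∃ r : ℕ, ∀ a b : Fin n, blockMoment m p a b = if a = b then r else 0 := by
          match p, ih with
          | 0, _ => exact ⟨1, blockMoment_zero⟩
          | 1, _ => exact ⟨m, fun a b => by simp [blockMoment_one, blockMoment_zero]⟩
          | p + 2, ih =>
            refine ⟨m * M (p + 1) + ∑ q ∈ antidiagonal p, N q.1 * M q.2, fun a b => ?_⟩
            have : ∀ q ∈ antidiagonal p, ∑ v, innerMoment m q.1 a v * blockMoment m q.2 v b =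
                if a = b then N q.1 * M q.2 else 0 := by
              intro q hq
              have hq := Finset.HasAntidiagonal.mem_antidiagonal.1 hq
              simp [(ih q.1 (by omega)).2, (ih q.2 (by omega)).1]
            rw [blockMoment_succ_succ, Finset.sum_congr rfl this, (ih (p + 1) (by omega)).1]
            split_ifs <;> simp
        obtain ⟨r, hr⟩ := aux
        have : M p = r := by simp [hM, hr]
        rwa [this]
      refine ⟨scal, ?_⟩
      have aux : ∃ r : ℕ, ∀ a b : Fin n, innerMoment m p a b = if a = b then r else 0 := by
        match p, ih, scal with
        | 0, _, _ => exact ⟨n * m, fun a b => by simp [innerMoment_zero, eq_comm]⟩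
        | p + 1, ih, scal =>
          refine ⟨_, inner p (fun q hq => ?_) fun q hq => (ih q (by omega)).2⟩
          rcases Nat.lt_or_eq_of_le hq with h | rfl
          exacts [(ih q h).1, scal]
      obtain ⟨r, hr⟩ := aux
      have : N p = r := by simp [hN, hr]
      rwa [this]
  have hT := fun p => (key p).1
  have hR := fun p => (key p).2
  refine ⟨M, N, hT, ?_, ?_, fun p => ?_, ?_, fun p => ?_⟩
  · simp [hM, blockMoment_zero]
  · simp [hM, blockMoment_one, blockMoment_zero]
  · rw [hM, blockMoment_succ_succ]
    simp [hT, hR]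
  · simp [hN, innerMoment_zero]
  · rw [hN, inner p (fun q _ => hT q) (fun q _ => hR q), if_pos rfl]

end LimitMoments

/-! ### Generating function: Catalan bound and equation -/

section GeneratingFunction

variable {m n : ℕ} {M N : ℕ → ℕ}

/-- Each recursion is dominated by a Catalan convolution: one boundary term majorizes the linear
term, the other terms majorize the sum. The index of the bound on `N` is shifted by one because `N
q.1` meets the factor `catalan (q.1 + 1)`. -/
theorem moment_le_catalan (hm : 1 ≤ m) (hn : 1 ≤ n) (h0 : M 0 = 1) (h1 : M 1 = m)
    (hM : ∀ p, M (p + 2) = m * M (p + 1) + ∑ q ∈ antidiagonal p, N q.1 * M q.2)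
    (hN0 : N 0 = n * m)
    (hN : ∀ p, N (p + 1) = n * m * M (p + 1) + ∑ q ∈ antidiagonal p, M q.1 * M (q.2 + 1)) (p : ℕ) :
    M p ≤ (n * m) ^ p * catalan p ∧ N p ≤ (n * m) ^ (p + 1) * catalan (p + 1) := by
  have hc : m ≤ n * m := Nat.le_mul_of_pos_left m hn
  induction p using Nat.strong_induction_on with
  | _ p ih =>
    have hMp : M p ≤ (n * m) ^ p * catalan p := by
      match p, ih with
      | 0, _ => simp [h0]
      | 1, _ => simpa [h1] using hc
      | p + 2, ih =>
        rw [hM, catalan_succ' (p + 1), Finset.Nat.sum_antidiagonal_succ, mul_add]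
        refine add_le_add ?_ ?_
        · rw [pow_succ', mul_assoc, catalan_zero, one_mul]
          exact Nat.mul_le_mul hc (ih (p + 1) (by omega)).1
        · rw [Finset.mul_sum]
          refine Finset.sum_le_sum fun q hq => ?_
          have hq := Finset.HasAntidiagonal.mem_antidiagonal.1 hq
          calc N q.1 * M q.2 ≤ ((n * m) ^ (q.1 + 1) * catalan (q.1 + 1)) *
                ((n * m) ^ q.2 * catalan q.2) :=
                Nat.mul_le_mul (ih q.1 (by omega)).2 (ih q.2 (by omega)).1
            _ = (n * m) ^ (p + 1) * (catalan (q.1 + 1) * catalan q.2) := by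
                rw [← hq]; ring
            -- The convolution produces one power of nm fewer than allowed; nm ≥ 1 absorbs the
            -- difference.
            _ ≤ _ := Nat.mul_le_mul_right _ (Nat.pow_le_pow_right (by nlinarith) (by omega))
    refine ⟨hMp, ?_⟩
    match p, ih, hMp with
    | 0, _, _ => simp [hN0]
    | p + 1, ih, hMp =>
      have hM' : ∀ q ≤ p + 1, M q ≤ (n * m) ^ q * catalan q := by
        intro q hq
        rcases Nat.lt_or_eq_of_le hq with h | rfl
        exacts [(ih q h).1, hMp]
      rw [hN, catalan_succ' (p + 1), Finset.Nat.sum_antidiagonal_succ', mul_add]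
      refine add_le_add ?_ ?_
      · rw [catalan_zero, mul_one, pow_succ', mul_assoc (n * m)]
        exact Nat.mul_le_mul_left _ hMp
      · rw [Finset.mul_sum]
        refine Finset.sum_le_sum fun q hq => ?_
        have hq := Finset.HasAntidiagonal.mem_antidiagonal.1 hq
        calc M q.1 * M (q.2 + 1) ≤ ((n * m) ^ q.1 * catalan q.1) *
              ((n * m) ^ (q.2 + 1) * catalan (q.2 + 1)) :=
              Nat.mul_le_mul (hM' _ (by omega)) (hM' _ (by omega))
          _ = (n * m) ^ (p + 1) * (catalan q.1 * catalan (q.2 + 1)) := by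
              rw [← hq]; ring
          _ ≤ _ := Nat.mul_le_mul_right _ (Nat.pow_le_pow_right (by nlinarith) (by omega))

theorem catalan_le_four_pow (p : ℕ) : catalan p ≤ 4 ^ p := by
  rw [catalan_eq_centralBinom_div]
  refine (Nat.div_le_self _ _).trans ?_
  rw [Nat.centralBinom_eq_two_mul_choose, show 4 = 2 ^ 2 by norm_num, ← pow_mul]
  exact Nat.choose_le_two_pow _ _

theorem powerSeries_equation (R : Type*) [CommRing R] (h0 : M 0 = 1) (h1 : M 1 = m)
    (hM : ∀ p, M (p + 2) = m * M (p + 1) + ∑ q ∈ antidiagonal p, N q.1 * M q.2)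
    (hN0 : N 0 = n * m)
    (hN : ∀ p, N (p + 1) = n * m * M (p + 1) + ∑ q ∈ antidiagonal p, M q.1 * M (q.2 + 1))
    {F : PowerSeries R} (hF : F = PowerSeries.mk fun p => (M p : R)) :
    (F - 1) * (1 - PowerSeries.X ^ 2 * F ^ 2) =
      (m : PowerSeries R) * PowerSeries.X * F * (1 + (n : PowerSeries R) * PowerSeries.X * F) := by
  set H : PowerSeries R := PowerSeries.mk fun p => (N p : R) with hH
  set F' : PowerSeries R := PowerSeries.mk fun p => (M (p + 1) : R) with hF'
  have natCast_coeff : ∀ (k : ℕ) (A : PowerSeries R) (p : ℕ),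
      PowerSeries.coeff p ((k : PowerSeries R) * A) = k * PowerSeries.coeff p A := by
    intro k A p
    rw [← map_natCast (PowerSeries.C (R := R)), PowerSeries.coeff_C_mul]
  have e1 : F = 1 + PowerSeries.X * F' := by
    ext p
    cases p <;> simp [hF, hF', h0, PowerSeries.coeff_succ_X_mul, PowerSeries.coeff_one]
  have e2 : F' = (m : PowerSeries R) * F + PowerSeries.X * (H * F) := by
    ext p
    cases p with
    | zero => simp [hF, hF', h0, h1]
    | succ p =>
      rw [map_add, natCast_coeff, PowerSeries.coeff_succ_X_mul, PowerSeries.coeff_mul]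
      simp [hF, hF', hH, hM]
  have e3 : H = (n : PowerSeries R) * ((m : PowerSeries R) * F) + PowerSeries.X * (F * F') := by
    ext p
    rw [map_add, natCast_coeff, natCast_coeff]
    cases p with
    | zero => simp [hF, hH, h0, hN0]
    | succ p =>
      rw [PowerSeries.coeff_succ_X_mul, PowerSeries.coeff_mul]
      simp [hF, hF', hH, hN, mul_assoc]
  have e4 : PowerSeries.X * F' = F - 1 := by rw [e1]; ring
  have e5 : F - 1 = PowerSeries.X * ((m : PowerSeries R) * F + PowerSeries.X * (H * F)) := by
    rw [← e2, e4]
  -- Removing the shifted series leaves two relations between F and H; substituting this one for H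
  -- gives the equation.
  have e6 : H = (n : PowerSeries R) * ((m : PowerSeries R) * F) + F * (F - 1) := by
    rw [e3, ← e4]; ring
  rw [e6] at e5
  linear_combination e5

/-- The power series `A` converges absolutely at `z`, with sum `v`. -/
def AbsSumsTo (z : ℂ) (A : PowerSeries ℂ) (v : ℂ) : Prop :=
  (Summable fun p => ‖PowerSeries.coeff p A * z ^ p‖) ∧
    HasSum (fun p => PowerSeries.coeff p A * z ^ p) v

namespace AbsSumsTo

variable {z v w : ℂ} {A B : PowerSeries ℂ}

theorem unique (hA : AbsSumsTo z A v) (hA' : AbsSumsTo z A w) : v = w := hA.2.unique hA'.2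

theorem add (hA : AbsSumsTo z A v) (hB : AbsSumsTo z B w) : AbsSumsTo z (A + B) (v + w) := by
  have : (fun p => PowerSeries.coeff p (A + B) * z ^ p) =
      fun p => PowerSeries.coeff p A * z ^ p + PowerSeries.coeff p B * z ^ p := by
    ext p
    rw [map_add, add_mul]
  refine ⟨?_, this ▸ hA.2.add hB.2⟩
  simp only [congrFun this]
  exact Summable.of_nonneg_of_le (fun _ => norm_nonneg _) (fun _ => norm_add_le _ _)
    (hA.1.add hB.1)

theorem mul (hA : AbsSumsTo z A v) (hB : AbsSumsTo z B w) : AbsSumsTo z (A * B) (v * w) := by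
  have : (fun p => PowerSeries.coeff p (A * B) * z ^ p) = fun p => ∑ q ∈ antidiagonal p,
      PowerSeries.coeff q.1 A * z ^ q.1 * (PowerSeries.coeff q.2 B * z ^ q.2) := by
    ext p
    rw [PowerSeries.coeff_mul, Finset.sum_mul]
    refine Finset.sum_congr rfl fun q hq => ?_
    rw [← Finset.HasAntidiagonal.mem_antidiagonal.1 hq]
    ring
  have hs := summable_norm_sum_mul_antidiagonal_of_summable_norm hA.1 hB.1
  refine ⟨by simpa only [congrFun this] using hs, ?_⟩
  rw [this, ← hA.2.tsum_eq, ← hB.2.tsum_eq,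
    tsum_mul_tsum_eq_tsum_sum_antidiagonal_of_summable_norm hA.1 hB.1]
  exact hs.of_norm.hasSum

theorem const (z a : ℂ) : AbsSumsTo z (PowerSeries.C a) a := by
  have h : ∀ p ≠ 0, PowerSeries.coeff p (PowerSeries.C a) * z ^ p = 0 := by
    intro p hp
    simp [PowerSeries.coeff_C, hp]
  refine ⟨summable_of_ne_finset_zero (s := {0}) fun p hp => ?_, ?_⟩
  · rw [h p (by simpa using hp), norm_zero]
  · simpa using hasSum_single 0 h

theorem natCast (z : ℂ) (k : ℕ) : AbsSumsTo z (k : PowerSeries ℂ) k := by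
  simpa using const z (k : ℂ)

theorem one (z : ℂ) : AbsSumsTo z 1 1 := by
  simpa using const z 1

theorem X (z : ℂ) : AbsSumsTo z PowerSeries.X z := by
  have h : ∀ p ≠ 1, PowerSeries.coeff p (PowerSeries.X : PowerSeries ℂ) * z ^ p = 0 := by
    intro p hp
    simp [PowerSeries.coeff_X, hp]
  refine ⟨summable_of_ne_finset_zero (s := {1}) fun p hp => ?_, ?_⟩
  · rw [h p (by simpa using hp), norm_zero]
  · simpa using hasSum_single 1 h

theorem sub (hA : AbsSumsTo z A v) (hB : AbsSumsTo z B w) : AbsSumsTo z (A - B) (v - w) := by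
  have := hA.add ((const z (-1)).mul hB)
  simpa [sub_eq_add_neg] using this

end AbsSumsTo

theorem exists_hasSum_equation (hm : 1 ≤ m) (hn : 1 ≤ n) (h0 : M 0 = 1) (h1 : M 1 = m)
    (hM : ∀ p, M (p + 2) = m * M (p + 1) + ∑ q ∈ antidiagonal p, N q.1 * M q.2)
    (hN0 : N 0 = n * m)
    (hN : ∀ p, N (p + 1) = n * m * M (p + 1) + ∑ q ∈ antidiagonal p, M q.1 * M (q.2 + 1))
    {z : ℂ} (hz : ‖z‖ < (4 * (m : ℝ) * (n : ℝ))⁻¹) :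
    ∃ F : ℂ, HasSum (fun p => (M p : ℂ) * z ^ p) F ∧
      (F - 1) * (1 - z ^ 2 * F ^ 2) = (m : ℂ) * z * F * (1 + (n : ℂ) * z * F) := by
  have hpos : (0 : ℝ) < 4 * m * n := by positivity
  have hr : 4 * m * n * ‖z‖ < 1 := by
    exact (mul_lt_mul_of_pos_left hz hpos).trans_eq (mul_inv_cancel₀ hpos.ne')
  have hs : Summable fun p => ‖(M p : ℂ) * z ^ p‖ := by
    refine Summable.of_nonneg_of_le (fun _ => norm_nonneg _) (fun p => ?_)
      (summable_geometric_of_lt_one (by positivity) hr)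
    have h : (M p : ℝ) ≤ (4 * m * n) ^ p := by
      have := (moment_le_catalan hm hn h0 h1 hM hN0 hN p).1.trans
        (Nat.mul_le_mul_left _ (catalan_le_four_pow p))
      calc (M p : ℝ) ≤ (n * m) ^ p * 4 ^ p := by exact_mod_cast this
        _ = _ := by rw [← mul_pow]; ring
    rw [norm_mul, norm_pow, Complex.norm_natCast, mul_pow]
    gcongr
  obtain ⟨v, hv⟩ := hs.of_norm
  set F : PowerSeries ℂ := PowerSeries.mk fun p => (M p : ℂ) with hF
  have hA : AbsSumsTo z F v := by
    simpa [AbsSumsTo, hF] using And.intro hs hv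
  refine ⟨v, hv, ?_⟩
  have hX := AbsSumsTo.X z
  have hone := AbsSumsTo.one z
  have eq := powerSeries_equation ℂ h0 h1 hM hN0 hN hF
  -- Absolute convergence makes evaluation at z compatible with Cauchy products, so both sides of
  -- the formal identity can be evaluated and compared by uniqueness of sums.
  have l := (hA.sub hone).mul (hone.sub ((hX.mul hX).mul (hA.mul hA)))
  have r := (((AbsSumsTo.natCast z m).mul hX).mul hA).mul
    (hone.add (((AbsSumsTo.natCast z n).mul hX).mul hA))
  rw [← sq, ← sq, eq] at l
  rw [← l.unique r]
  ring

end GeneratingFunction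

/-! ### Moments of one complex Gaussian variable -/

section GaussianMoments

open ComplexConjugate

theorem integrable_pow_mul_conj_pow {α : Type*} [MeasurableSpace α] {μ : Measure α}
    [IsFiniteMeasure μ] {Z : α → ℂ} (hZ : ∀ p : ℕ, MemLp Z p μ) (k l : ℕ) :
    Integrable (fun x => Z x ^ k * conj (Z x) ^ l) μ := by
  have hm : AEStronglyMeasurable Z μ := (hZ 0).aestronglyMeasurable
  refine (MemLp.integrable_norm_pow' (hZ (k + l))).mono' ?_ (ae_of_all _ fun x => ?_)
  · exact (hm.pow k).mul ((Complex.continuous_conj.comp_aestronglyMeasurable hm).pow l)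
  · simp [pow_add]

theorem integrable_mul_pow_mul_conj_pow {α : Type*} [MeasurableSpace α] {μ : Measure α}
    [IsFiniteMeasure μ] {T Z : α → ℂ} (hT : MemLp T 2 μ) (hZ : ∀ p : ℕ, MemLp Z p μ) (k l : ℕ) :
    Integrable (fun x => T x * (Z x ^ k * conj (Z x) ^ l)) μ := by
  refine hT.integrable_mul (q := 2) ?_
  rw [memLp_two_iff_integrable_sq_norm (integrable_pow_mul_conj_pow hZ k l).aestronglyMeasurable]
  refine (MemLp.integrable_norm_pow' (hZ (2 * (k + l)))).congr (ae_of_all _ fun x => ?_)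
  simp only [norm_mul, norm_pow, RCLike.norm_conj]
  ring

/-- Integration by parts for a centered real Gaussian variable. -/
theorem integral_mul_gaussianReal {v : ℝ≥0} (hv : v ≠ 0) {f f' : ℝ → ℂ}
    (hd : ∀ x, HasDerivAt f (f' x) x) (hf : Integrable f (gaussianReal 0 v))
    (hf' : Integrable f' (gaussianReal 0 v))
    (hxf : Integrable (fun x : ℝ => (x : ℂ) * f x) (gaussianReal 0 v)) :
    ∫ x : ℝ, (x : ℂ) * f x ∂gaussianReal 0 v = v * ∫ x, f' x ∂gaussianReal 0 v := by
  have hv' : (v : ℝ) ≠ 0 := by exact_mod_cast hv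
  have conv : ∀ g : ℝ → ℂ, Integrable g (gaussianReal 0 v) →
      Integrable fun x => (gaussianPDFReal 0 v x : ℂ) * g x := by
    intro g hg
    rw [gaussianReal_of_var_ne_zero _ hv, integrable_withDensity_iff_integrable_smul'
      (measurable_gaussianPDF _ _) (ae_of_all _ fun _ => gaussianPDF_lt_top)] at hg
    simpa using hg
  -- The density φ satisfies φ' = -(x/v)φ; the claim is that the derivative of φf has integral zero.
  have hpdf : ∀ x, HasDerivAt (fun x : ℝ => (gaussianPDFReal 0 v x : ℂ))
      (-(x / v) * gaussianPDFReal 0 v x : ℂ) x := by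
    intro x
    have h1 : HasDerivAt (fun x : ℝ => -(x - 0) ^ 2 / (2 * (v : ℝ))) (-(x / v)) x := by
      convert! ((((hasDerivAt_id x).sub_const 0).pow 2).neg.div_const (2 * (v : ℝ))) using 1
      simp
      field_simp
    have h2 := (h1.exp.const_mul (√(2 * Real.pi * v))⁻¹).ofReal_comp
    simp only [gaussianPDFReal_def]
    convert! h2 using 1
    push_cast
    ring
  have key := integral_eq_zero_of_hasDerivAt_of_integrable
    (f := fun x : ℝ => (gaussianPDFReal 0 v x : ℂ) * f x)
    (f' := fun x : ℝ => -(v : ℂ)⁻¹ * ((gaussianPDFReal 0 v x : ℂ) * (x * f x)) +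
      (gaussianPDFReal 0 v x : ℂ) * f' x)
    (fun x => by
      convert! (hpdf x).mul (hd x) using 1
      ring)
    (((conv _ hxf).const_mul _).add (conv _ hf')) (conv _ hf)
  rw [integral_add ((conv _ hxf).const_mul _) (conv _ hf'), integral_const_mul] at key
  rw [integral_gaussianReal_eq_integral_smul hv, integral_gaussianReal_eq_integral_smul hv]
  simp only [Complex.real_smul]
  have hvC : ((v : ℝ) : ℂ) ≠ 0 := by exact_mod_cast hv'
  generalize (∫ x : ℝ, (gaussianPDFReal 0 v x : ℂ) * (x * f x)) = A at key ⊢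
  generalize (∫ x : ℝ, (gaussianPDFReal 0 v x : ℂ) * f' x) = B at key ⊢
  field_simp at key
  linear_combination -key

/-- Integration by parts along one real coordinate of a complex variable: c = 1 serves the real part
and c = i the imaginary part, `w` being the other coordinate's contribution. The truncated exponents
are harmless, since their coefficients vanish at 0. -/
theorem integral_mul_affine_gaussianReal {v : ℝ≥0} (hv : v ≠ 0) (c w : ℂ) (k l : ℕ) :
    ∫ t : ℝ, (t : ℂ) * ((c * t + w) ^ k * conj (c * t + w) ^ l) ∂gaussianReal 0 v =
      v * ∫ t : ℝ, (k * c * ((c * t + w) ^ (k - 1) * conj (c * t + w) ^ l) +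
        l * conj c * ((c * t + w) ^ k * conj (c * t + w) ^ (l - 1))) ∂gaussianReal 0 v := by
  have ht : ∀ p : ℕ, MemLp (fun t : ℝ => (t : ℂ)) p (gaussianReal 0 v) := fun p =>
    (memLp_id_gaussianReal' p (by simp)).ofReal
  have hZ : ∀ p : ℕ, MemLp (fun t : ℝ => c * t + w) p (gaussianReal 0 v) := fun p =>
    ((ht p).const_mul c).add (memLp_const w)
  have hi := integrable_pow_mul_conj_pow hZ
  have hd : ∀ t : ℝ, HasDerivAt (fun t : ℝ => c * t + w) c t := by
    intro t
    simpa using ((hasDerivAt_id t).ofReal_comp.const_mul c).add_const w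
  refine integral_mul_gaussianReal hv (fun t => ?_) (hi k l)
    (((hi _ _).const_mul _).add ((hi _ _).const_mul _)) ?_
  · convert! ((hd t).pow k).mul (((hd t).star).pow l) using 1
    simp
    ring
  · exact integrable_mul_pow_mul_conj_pow (ht 2) hZ k l

theorem memLp_complex_gaussian (p : ℕ) :
    MemLp (fun x : ℝ × ℝ => (⟨x.1, x.2⟩ : ℂ)) p
      ((gaussianReal 0 (1 / 2)).prod (gaussianReal 0 (1 / 2))) := by
  have ht : MemLp (fun t : ℝ => (t : ℂ)) p (gaussianReal 0 (1 / 2)) :=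
    (memLp_id_gaussianReal' p (by simp)).ofReal
  convert! (ht.comp_fst (gaussianReal 0 (1 / 2))).add
    ((ht.comp_snd (gaussianReal 0 (1 / 2))).mul_const Complex.I) using 2
  simp [Complex.mk_eq_add_mul_I]

theorem measurable_complex_mk : Measurable fun x : ℝ × ℝ => (⟨x.1, x.2⟩ : ℂ) := by
  exact Complex.measurableEquivRealProd.symm.measurable

instance : IsProbabilityMeasure stdComplexGaussian :=
  Measure.isProbabilityMeasure_map measurable_complex_mk.aemeasurable

theorem integrable_stdComplexGaussian (k l : ℕ) :
    Integrable (fun z => z ^ k * conj z ^ l) stdComplexGaussian := by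
  rw [stdComplexGaussian, integrable_map_measure (by fun_prop) measurable_complex_mk.aemeasurable]
  exact integrable_pow_mul_conj_pow memLp_complex_gaussian k l

/-- The mixed moments of the standard complex Gaussian law. -/
noncomputable def gaussianMoment (k l : ℕ) : ℂ := ∫ z, z ^ k * conj z ^ l ∂stdComplexGaussian

theorem gaussianMoment_swap (k l : ℕ) : gaussianMoment l k = conj (gaussianMoment k l) := by
  rw [gaussianMoment, gaussianMoment, ← integral_conj]
  congr 1 with z
  simp [mul_comm]

theorem gaussianMoment_eq (k l : ℕ) : gaussianMoment k l =
    ∫ x : ℝ × ℝ, (x.1 + x.2 * Complex.I) ^ k * conj (x.1 + x.2 * Complex.I : ℂ) ^ l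
      ∂((gaussianReal 0 (1 / 2)).prod (gaussianReal 0 (1 / 2))) := by
  rw [gaussianMoment, stdComplexGaussian, integral_map measurable_complex_mk.aemeasurable
    (by fun_prop)]
  simp [Complex.mk_eq_add_mul_I]

/-- Writing z = x + iy and integrating by parts in x and y produces (1/2)(∂_x + i∂_y), the
derivative in the conjugate variable, which kills z^k. -/
theorem gaussianMoment_succ_left (k l : ℕ) :
    gaussianMoment (k + 1) l = l * gaussianMoment k (l - 1) := by
  have hZ : ∀ p : ℕ, MemLp (fun x : ℝ × ℝ => (x.1 + x.2 * Complex.I : ℂ)) p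
      ((gaussianReal 0 (1 / 2)).prod (gaussianReal 0 (1 / 2))) := by
    intro p
    simpa only [Complex.mk_eq_add_mul_I] using memLp_complex_gaussian p
  have ht : MemLp (fun t : ℝ => (t : ℂ)) 2 (gaussianReal 0 (1 / 2)) :=
    (memLp_id_gaussianReal' 2 (by simp)).ofReal
  have hi := integrable_pow_mul_conj_pow hZ
  have h1 := integrable_mul_pow_mul_conj_pow (ht.comp_fst (gaussianReal 0 (1 / 2))) hZ k l
  have h2 := integrable_mul_pow_mul_conj_pow (ht.comp_snd (gaussianReal 0 (1 / 2))) hZ k l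
  have hadd : ∀ r s : ℂ, Integrable (fun x : ℝ × ℝ =>
      r * ((x.1 + x.2 * Complex.I) ^ (k - 1) * conj (x.1 + x.2 * Complex.I : ℂ) ^ l) +
      s * ((x.1 + x.2 * Complex.I) ^ k * conj (x.1 + x.2 * Complex.I : ℂ) ^ (l - 1)))
      ((gaussianReal 0 (1 / 2)).prod (gaussianReal 0 (1 / 2))) := fun r s =>
    ((hi _ _).const_mul r).add ((hi _ _).const_mul s)
  have hv : (1 / 2 : ℝ≥0) ≠ 0 := by norm_num
  have e1 := fun y : ℝ => integral_mul_affine_gaussianReal hv 1 (y * Complex.I) k l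
  have e2 := fun x : ℝ => integral_mul_affine_gaussianReal hv Complex.I x k l
  have s1 : ∫ x : ℝ × ℝ, (x.1 : ℂ) * ((x.1 + x.2 * Complex.I) ^ k *
      conj (x.1 + x.2 * Complex.I : ℂ) ^ l)
      ∂((gaussianReal 0 (1 / 2)).prod (gaussianReal 0 (1 / 2))) =
      1 / 2 * (k * gaussianMoment (k - 1) l + l * gaussianMoment k (l - 1)) := by
    rw [gaussianMoment_eq, gaussianMoment_eq, ← integral_const_mul, ← integral_const_mul,
      ← integral_add ((hi _ _).const_mul _) ((hi _ _).const_mul _), integral_prod_symm _ h1,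
      integral_prod_symm _ (hadd _ _),
      ← integral_const_mul]
    congr 1 with y
    simpa using e1 y
  have s2 : ∫ x : ℝ × ℝ, (x.2 : ℂ) * ((x.1 + x.2 * Complex.I) ^ k *
      conj (x.1 + x.2 * Complex.I : ℂ) ^ l)
      ∂((gaussianReal 0 (1 / 2)).prod (gaussianReal 0 (1 / 2))) =
      1 / 2 * (k * Complex.I * gaussianMoment (k - 1) l +
        l * -Complex.I * gaussianMoment k (l - 1)) := by
    rw [gaussianMoment_eq, gaussianMoment_eq, ← integral_const_mul, ← integral_const_mul,
      ← integral_add ((hi _ _).const_mul _) ((hi _ _).const_mul _), integral_prod _ h2,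
      integral_prod _ (hadd _ _),
      ← integral_const_mul]
    congr 1 with x
    simpa [add_comm, mul_comm] using e2 x
  have split : gaussianMoment (k + 1) l =
      ∫ x : ℝ × ℝ, ((x.1 : ℂ) * ((x.1 + x.2 * Complex.I) ^ k *
        conj (x.1 + x.2 * Complex.I : ℂ) ^ l) + Complex.I * ((x.2 : ℂ) *
        ((x.1 + x.2 * Complex.I) ^ k * conj (x.1 + x.2 * Complex.I : ℂ) ^ l)))
      ∂((gaussianReal 0 (1 / 2)).prod (gaussianReal 0 (1 / 2))) := by
    rw [gaussianMoment_eq]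
    congr 1 with x
    ring
  rw [split, integral_add h1 (h2.const_mul _), integral_const_mul, s1, s2]
  -- By i² = -1 the terms with coefficient k cancel and those with coefficient l add up.
  linear_combination (1 / 2 : ℂ) * (k * gaussianMoment (k - 1) l - l * gaussianMoment k (l - 1)) *
    Complex.I_sq

theorem gaussianMoment_succ_right (k l : ℕ) :
    gaussianMoment k (l + 1) = k * gaussianMoment (k - 1) l := by
  rw [gaussianMoment_swap, gaussianMoment_succ_left, map_mul, ← gaussianMoment_swap, map_natCast]

end GaussianMoments

/-! ### Gaussian expectation of polynomials -/

section Expectation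

open ComplexConjugate MvPolynomial

variable {K : Type*}

/-- The values of the variables `g_k` and their conjugates. -/
def conjPoint (g : K → ℂ) (x : K × Bool) : ℂ := if x.2 then conj (g x.1) else g x.1

variable [Fintype K]

theorem aeval_conjPoint_monomial (g : K → ℂ) (s : K × Bool →₀ ℕ) (a : ℂ) :
    aeval (conjPoint g) (monomial s a) =
      a * ∏ k, g k ^ s (k, false) * conj (g k) ^ s (k, true) := by
  rw [aeval_monomial, Finsupp.prod_fintype _ _ (fun _ => pow_zero _), Fintype.prod_prod_type]
  simp [conjPoint, mul_comm]

theorem integrable_aeval_conjPoint (Q : MvPolynomial (K × Bool) ℂ) :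
    Integrable (fun g : K → ℂ => aeval (conjPoint g) Q)
      (Measure.pi fun _ => stdComplexGaussian) := by
  induction Q using MvPolynomial.induction_on' with
  | monomial s a =>
    simp only [aeval_conjPoint_monomial]
    exact (Integrable.fintype_prod (f := fun k z => z ^ s (k, false) * conj z ^ s (k, true))
      fun k => integrable_stdComplexGaussian _ _).const_mul a
  | add P Q hP hQ =>
    simp only [map_add]
    exact hP.add hQ

/-- The expectation of a polynomial in independent standard complex Gaussian variables and their
conjugates. -/
noncomputable def expectation (K : Type*) [Fintype K] : MvPolynomial (K × Bool) ℂ →ₗ[ℂ] ℂ where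
  toFun Q := ∫ g : K → ℂ, aeval (conjPoint g) Q ∂Measure.pi fun _ => stdComplexGaussian
  map_add' P Q := by
    simp only [map_add]
    exact integral_add (integrable_aeval_conjPoint P) (integrable_aeval_conjPoint Q)
  map_smul' c Q := by
    simp only [map_smul, smul_eq_mul, integral_const_mul, RingHom.id_apply]

theorem expectation_apply (Q : MvPolynomial (K × Bool) ℂ) : expectation K Q =
    ∫ g : K → ℂ, aeval (conjPoint g) Q ∂Measure.pi fun _ => stdComplexGaussian := rfl

theorem expectation_monomial (s : K × Bool →₀ ℕ) (a : ℂ) :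
    expectation K (monomial s a) = a * ∏ k, gaussianMoment (s (k, false)) (s (k, true)) := by
  simp only [expectation_apply, aeval_conjPoint_monomial, integral_const_mul]
  rw [integral_fintype_prod_eq_prod
    (f := fun k z => z ^ s (k, false) * conj z ^ s (k, true))]
  rfl

theorem expectation_one : expectation K 1 = 1 := by
  simp [expectation_apply]

/-- Gaussian integration by parts. -/
theorem expectation_X_mul [DecidableEq K] (k : K) (b : Bool) (Q : MvPolynomial (K × Bool) ℂ) :
    expectation K (X (k, b) * Q) = expectation K (pderiv (k, !b) Q) := by
  induction Q using MvPolynomial.induction_on' with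
  | monomial s a =>
    rw [pderiv_monomial, X, monomial_mul, one_mul, expectation_monomial, expectation_monomial,
      Fintype.prod_eq_mul_prod_compl k, Fintype.prod_eq_mul_prod_compl k]
    -- The expectation of a monomial factors over the entries and only the factor of `k` changes,
    -- which reduces the claim to the one-variable recursions.
    have : ∀ j ∈ ({k} : Finset K)ᶜ,
        gaussianMoment ((Finsupp.single (k, b) 1 + s : K × Bool →₀ ℕ) (j, false))
          ((Finsupp.single (k, b) 1 + s : K × Bool →₀ ℕ) (j, true)) =
        gaussianMoment ((s - Finsupp.single (k, !b) 1 : K × Bool →₀ ℕ) (j, false))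
          ((s - Finsupp.single (k, !b) 1 : K × Bool →₀ ℕ) (j, true)) := by
      intro j hj
      have hj : k ≠ j := by simpa [eq_comm] using hj
      simp [hj]
    rw [Finset.prod_congr rfl this]
    cases b
    · simp [add_comm 1, gaussianMoment_succ_left]
      ring
    · simp [add_comm 1, gaussianMoment_succ_right]
      ring
  | add P Q hP hQ => rw [mul_add, map_add, map_add, map_add, hP, hQ]

end Expectation

/-! ### Loop equation and asymptotic factorization -/

section LoopEquation

open MvPolynomial

variable {d n m : ℕ}

/-- The index set of the entries of `G`. -/
abbrev Entry (d n m : ℕ) : Type := (Fin d × Fin n) × (Fin d × Fin m)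

/-- The variable at position `(i, j)` of the block (or adjoint of a block) given by a letter. -/
def entryVar (x : Letter n m) (i j : Fin d) : Entry d n m × Bool :=
  if x.2 then (((j, x.1.1), (i, x.1.2)), true) else (((i, x.1.1), (j, x.1.2)), false)

theorem entryVar_inj {x y : Letter n m} {i j p q : Fin d} :
    entryVar x i j = entryVar y p q ↔ x = y ∧ i = p ∧ j = q := by
  obtain ⟨⟨a, c⟩, b⟩ := x
  obtain ⟨⟨a', c'⟩, b'⟩ := y
  cases b <;> cases b' <;> simp [entryVar] <;> tauto

theorem expectation_entryVar_mul (x : Letter n m) (i j : Fin d)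
    (Q : MvPolynomial (Entry d n m × Bool) ℂ) :
    expectation (Entry d n m) (X (entryVar x i j) * Q) =
      expectation (Entry d n m) (pderiv (entryVar (adj x) j i) Q) := by
  obtain ⟨⟨a, c⟩, b⟩ := x
  cases b <;> simp [entryVar, adj, expectation_X_mul]

/-- The normalization `d^{-1/2}` of the blocks. -/
noncomputable def scale (d : ℕ) : ℂ := ((√(d : ℝ))⁻¹ : ℝ)

theorem scale_mul_scale (d : ℕ) : scale d * scale d = (d : ℂ)⁻¹ := by
  rw [scale, ← Complex.ofReal_mul, ← mul_inv, Real.mul_self_sqrt (Nat.cast_nonneg d)]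
  simp

/-- The normalized block of `G`, or adjoint of a block, given by a letter. -/
noncomputable def letterMatrix (d : ℕ) (x : Letter n m) :
    Matrix (Fin d) (Fin d) (MvPolynomial (Entry d n m × Bool) ℂ) :=
  Matrix.of fun i j => C (scale d) * X (entryVar x i j)

theorem letterMatrix_apply (x : Letter n m) (i j : Fin d) :
    letterMatrix d x i j = C (scale d) * X (entryVar x i j) := rfl

theorem pderiv_letterMatrix (x y : Letter n m) (i j p q : Fin d) :
    pderiv (entryVar y p q) (letterMatrix d x i j) =
      if x = y ∧ i = p ∧ j = q then C (scale d) else 0 := by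
  rw [letterMatrix_apply, pderiv_C_mul, pderiv_X, Pi.single_apply]
  simp only [entryVar_inj]
  split_ifs <;> simp_all

/-- The product of the matrices given by the letters of a word. -/
noncomputable def wordMatrix (d : ℕ) (w : List (Letter n m)) :
    Matrix (Fin d) (Fin d) (MvPolynomial (Entry d n m × Bool) ℂ) :=
  (w.map (letterMatrix d)).prod

theorem wordMatrix_nil : wordMatrix d ([] : List (Letter n m)) = 1 := rfl

theorem wordMatrix_cons (x : Letter n m) (w : List (Letter n m)) :
    wordMatrix d (x :: w) = letterMatrix d x * wordMatrix d w := by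
  simp [wordMatrix]

theorem wordMatrix_append (u v : List (Letter n m)) :
    wordMatrix d (u ++ v) = wordMatrix d u * wordMatrix d v := by
  simp [wordMatrix]

/-- Leibniz rule: differentiating an occurrence of `y` replaces it by a multiple of a matrix unit,
which cuts the product there. -/
theorem pderiv_wordMatrix (y : Letter n m) (w : List (Letter n m)) (i j p q : Fin d) :
    pderiv (entryVar y p q) (wordMatrix d w i j) =
      C (scale d) * sumSplits y w fun u v => wordMatrix d u i p * wordMatrix d v q j := by
  induction w generalizing i with
  | nil =>
    rw [wordMatrix_nil, Matrix.one_apply]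
    split_ifs <;> simp
  | cons z w ih =>
    rw [wordMatrix_cons, Matrix.mul_apply, map_sum]
    simp only [pderiv_mul, pderiv_letterMatrix, ih, Finset.sum_add_distrib, sumSplits_cons,
      wordMatrix_cons, wordMatrix_nil, mul_add]
    congr 1
    · by_cases hz : z = y <;> by_cases hi : i = p <;> simp [hz, hi, Matrix.one_apply]
    · simp only [mul_left_comm _ (C (scale d)), ← Finset.mul_sum, sumSplits_mul_left,
        sum_sumSplits, Matrix.mul_apply, Finset.sum_mul, mul_assoc]

/-- The normalized trace of the matrix given by a word. -/
noncomputable def wordTrace (d : ℕ) (w : List (Letter n m)) :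
    MvPolynomial (Entry d n m × Bool) ℂ :=
  C (d : ℂ)⁻¹ * (wordMatrix d w).trace

theorem wordTrace_nil (hd : d ≠ 0) : wordTrace d ([] : List (Letter n m)) = 1 := by
  have : (d : ℂ) ≠ 0 := by exact_mod_cast hd
  rw [wordTrace, wordMatrix_nil, Matrix.trace_one, Fintype.card_fin,
    ← map_natCast (C : ℂ →+* MvPolynomial (Entry d n m × Bool) ℂ), ← C_mul, inv_mul_cancel₀ this,
    C_1]

theorem trace_wordMatrix (hd : d ≠ 0) (w : List (Letter n m)) :
    (wordMatrix d w).trace = C (d : ℂ) * wordTrace d w := by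
  have : (d : ℂ) ≠ 0 := by exact_mod_cast hd
  rw [wordTrace, ← mul_assoc, ← C_mul, mul_inv_cancel₀ this, C_1, one_mul]

/-- A trace is cyclic, so cutting it at one letter leaves a single open word, the part after the cut
followed by the part before. -/
theorem pderiv_wordTrace (y : Letter n m) (w : List (Letter n m)) (p q : Fin d) :
    pderiv (entryVar y p q) (wordTrace d w) =
      C ((d : ℂ)⁻¹ * scale d) * sumSplits y w fun u v => wordMatrix d (v ++ u) q p := by
  rw [wordTrace, pderiv_C_mul, Matrix.trace, map_sum]
  simp only [Matrix.diag_apply, pderiv_wordMatrix, ← Finset.mul_sum, sum_sumSplits,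
    wordMatrix_append, Matrix.mul_apply, C_mul, mul_assoc]
  simp only [mul_comm]

/-- A product of normalized traces of words. -/
noncomputable def traceProd (d : ℕ) (ws : List (List (Letter n m))) :
    MvPolynomial (Entry d n m × Bool) ℂ :=
  (ws.map (wordTrace d)).prod

theorem traceProd_nil : traceProd d ([] : List (List (Letter n m))) = 1 := rfl

theorem traceProd_cons (w : List (Letter n m)) (ws : List (List (Letter n m))) :
    traceProd d (w :: ws) = wordTrace d w * traceProd d ws := by
  simp [traceProd]

/-- The lists of words obtained by gluing the word `w` into one of the words of `ws` in place of
an occurrence of the letter `y`. -/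
def gluings (y : Letter n m) (w : List (Letter n m)) :
    List (List (Letter n m)) → List (List (List (Letter n m)))
  | [] => []
  | w' :: ws => ((splits y w').map fun p => (w ++ (p.2 ++ p.1)) :: ws) ++
      (gluings y w ws).map fun r => w' :: r

/-- The complexity of a list of words. -/
def weight (ws : List (List (Letter n m))) : ℕ := (ws.map fun w => w.length + 1).sum

theorem weight_cons (w : List (Letter n m)) (ws : List (List (Letter n m))) :
    weight (w :: ws) = w.length + 1 + weight ws := by
  simp [weight]

theorem weight_of_mem_gluings {y : Letter n m} {w : List (Letter n m)}
    {ws r : List (List (Letter n m))} (hr : r ∈ gluings y w ws) :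
    weight r + 1 = w.length + weight ws := by
  induction ws generalizing r with
  | nil => simp [gluings] at hr
  | cons w' ws ih =>
    simp only [gluings, List.mem_append, List.mem_map] at hr
    rcases hr with ⟨p, hp, rfl⟩ | ⟨r, hr, rfl⟩
    · have := length_of_mem_splits hp
      simp only [weight_cons, List.length_append]
      omega
    · have := ih hr
      simp only [weight_cons]
      omega

/-- Contracting `w` with a trace that has been cut open closes both into one trace; the d needed to
normalize it cancels the d^{-1} of the trace cut open. -/
theorem sum_wordMatrix_mul_pderiv_traceProd (hd : d ≠ 0) (y : Letter n m) (w : List (Letter n m))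
    (ws : List (List (Letter n m))) :
    ∑ p, ∑ q, wordMatrix d w p q * pderiv (entryVar y p q) (traceProd d ws) =
      C (scale d) * ((gluings y w ws).map (traceProd d)).sum := by
  induction ws with
  | nil => simp [traceProd_nil, gluings]
  | cons w' ws ih =>
    have h : ∀ p q, wordMatrix d w p q * pderiv (entryVar y p q) (traceProd d (w' :: ws)) =
        C ((d : ℂ)⁻¹ * scale d) * ((sumSplits y w' fun u v =>
          wordMatrix d w p q * wordMatrix d (v ++ u) q p) * traceProd d ws) +
        wordTrace d w' * (wordMatrix d w p q * pderiv (entryVar y p q) (traceProd d ws)) := by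
      intro p q
      rw [traceProd_cons, pderiv_mul, pderiv_wordTrace, ← sumSplits_mul_left]
      ring
    simp only [h, Finset.sum_add_distrib, ← Finset.mul_sum, ih, ← Finset.sum_mul, sum_sumSplits]
    have h2 : (sumSplits y w' fun u v => ∑ p, ∑ q, wordMatrix d w p q * wordMatrix d (v ++ u) q p) =
        C (d : ℂ) * sumSplits y w' fun u v => wordTrace d (w ++ (v ++ u)) := by
      simp only [sumSplits_mul_left, ← trace_wordMatrix hd, wordMatrix_append w, Matrix.trace,
        Matrix.diag_apply, Matrix.mul_apply]
    have hd' : (d : ℂ) ≠ 0 := by exact_mod_cast hd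
    have h3 : C ((d : ℂ)⁻¹ * scale d) * C (d : ℂ) =
        (C (scale d) : MvPolynomial (Entry d n m × Bool) ℂ) := by
      rw [← C_mul]
      congr 1
      field_simp
    rw [h2, mul_assoc (C (d : ℂ)), ← mul_assoc, h3, sumSplits_mul_right, gluings, List.map_append,
      List.sum_append, mul_add, mul_left_comm]
    congr 2
    · simp [sumSplits, traceProd_cons, Function.comp_def]
    · simp [traceProd_cons, Function.comp_def, List.sum_map_mul_left]

/-- The loop (Schwinger–Dyson) equation at finite `d`. -/
theorem expectation_traceProd_cons (hd : d ≠ 0) (x : Letter n m) (w : List (Letter n m))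
    (ws : List (List (Letter n m))) :
    expectation (Entry d n m) (traceProd d ((x :: w) :: ws)) =
      (sumSplits (adj x) w fun u v => expectation (Entry d n m) (traceProd d (u :: v :: ws))) +
      (d : ℂ)⁻¹ ^ 2 *
        ((gluings (adj x) w ws).map fun r => expectation (Entry d n m) (traceProd d r)).sum := by
  have hd' : (d : ℂ) ≠ 0 := by exact_mod_cast hd
  have h1 : traceProd d ((x :: w) :: ws) = ∑ i, ∑ k, ((d : ℂ)⁻¹ * scale d) •
      (X (entryVar x i k) * (wordMatrix d w k i * traceProd d ws)) := by
    simp only [traceProd_cons, wordTrace, wordMatrix_cons, Matrix.trace, Matrix.diag_apply,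
      Matrix.mul_apply, Finset.mul_sum, Finset.sum_mul, letterMatrix_apply, smul_eq_C_mul, C_mul]
    refine Finset.sum_congr rfl fun i _ => Finset.sum_congr rfl fun k _ => ?_
    ring
  have h2 : ∑ i : Fin d, ∑ k : Fin d, pderiv (entryVar (adj x) k i)
        (wordMatrix d w k i * traceProd d ws) =
      scale d • ((C (d : ℂ) ^ 2 * sumSplits (adj x) w fun u v => traceProd d (u :: v :: ws)) +
        ((gluings (adj x) w ws).map (traceProd d)).sum) := by
    have h3 : ∀ k i, pderiv (entryVar (adj x) k i) (wordMatrix d w k i) * traceProd d ws =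
        C (scale d) * sumSplits (adj x) w fun u v =>
          wordMatrix d u k k * wordMatrix d v i i * traceProd d ws := by
      intro k i
      rw [pderiv_wordMatrix, mul_assoc, sumSplits_mul_right]
    -- Both indices are free, so two full traces appear. Their d² cancels the d^{-2} of the
    -- normalization, whereas the gluing terms keep it.
    have h4 : ∀ u v : List (Letter n m),
        ∑ k, ∑ i, wordMatrix d u k k * wordMatrix d v i i * traceProd d ws =
          C (d : ℂ) ^ 2 * traceProd d (u :: v :: ws) := by
      intro u v
      have hu := trace_wordMatrix hd u
      have hv := trace_wordMatrix hd v
      simp only [Matrix.trace, Matrix.diag_apply] at hu hv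
      simp only [← Finset.sum_mul, ← Finset.mul_sum]
      rw [hu, hv, traceProd_cons, traceProd_cons]
      ring
    rw [smul_eq_C_mul, mul_add, ← sum_wordMatrix_mul_pderiv_traceProd hd, Finset.sum_comm]
    simp only [pderiv_mul, Finset.sum_add_distrib, h3, ← Finset.mul_sum, sum_sumSplits, h4,
      sumSplits_mul_left]
  have h3 : (d : ℂ)⁻¹ * scale d * scale d = (d : ℂ)⁻¹ ^ 2 := by
    rw [mul_assoc, scale_mul_scale, sq]
  rw [h1]
  simp only [map_sum, map_smul, expectation_entryVar_mul, ← Finset.smul_sum]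
  simp only [← map_sum]
  rw [h2, map_smul, smul_smul, h3, map_add, ← C_pow, ← smul_eq_C_mul, map_smul, sumSplits_map,
    map_list_sum, List.map_map, smul_add, smul_smul, ← mul_pow, inv_mul_cancel₀ hd', one_pow,
    one_smul, smul_eq_mul]
  rfl

/-- Mixed moments of traces of words factorize asymptotically, and converge to the moments of a
free circular family. -/
theorem tendsto_expectation_traceProd (ws : List (List (Letter n m))) :
    Tendsto (fun d => expectation (Entry d n m) (traceProd d ws)) atTop
      (𝓝 ((ws.map fun w => (freeMoment w : ℂ)).prod)) := by
  -- Every move lowers the weight: dropping an empty word by 1; a split by 1, losing two letters and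
  -- gaining a word; a gluing by 3, losing two letters and a word.
  induction hN : weight ws using Nat.strong_induction_on generalizing ws with
  | _ N ih =>
    have ih' : ∀ r : List (List (Letter n m)), weight r < weight ws →
        Tendsto (fun d => expectation (Entry d n m) (traceProd d r)) atTop
          (𝓝 ((r.map fun w => (freeMoment w : ℂ)).prod)) :=
      fun r hr => ih (weight r) (hN ▸ hr) r rfl
    match ws, ih' with
    | [], _ => simp [traceProd_nil, expectation_one]
    | [] :: ws, ih' =>
      have h := ih' ws (by simp [weight_cons])
      simp only [List.map_cons, freeMoment_nil, Nat.cast_one, List.prod_cons, one_mul]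
      refine h.congr' ?_
      filter_upwards [eventually_ne_atTop 0] with d hd
      rw [traceProd_cons, wordTrace_nil hd, one_mul]
    | (x :: w) :: ws, ih' =>
      have h1 : Tendsto (fun d => sumSplits (adj x) w fun u v =>
          expectation (Entry d n m) (traceProd d (u :: v :: ws))) atTop
          (𝓝 (((x :: w) :: ws).map fun w => (freeMoment w : ℂ)).prod) := by
        rw [List.map_cons, List.prod_cons, freeMoment_cons,
          show ∀ k : ℕ, (k : ℂ) = Nat.castAddMonoidHom ℂ k from fun _ => rfl, sumSplits_map,
          sumSplits_mul_right]
        refine tendsto_list_sum _ fun p hp => ?_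
        have hp := length_of_mem_splits hp
        convert! ih' (p.1 :: p.2 :: ws) (by simp only [weight_cons, List.length_cons]; omega) using 2
        simp [mul_assoc]
      have h2 : Tendsto (fun d => ((gluings (adj x) w ws).map fun r =>
          expectation (Entry d n m) (traceProd d r)).sum) atTop
          (𝓝 ((gluings (adj x) w ws).map fun r => (r.map fun w => (freeMoment w : ℂ)).prod).sum) :=
        tendsto_list_sum _ fun r hr => ih' r (by
          have := weight_of_mem_gluings hr
          simp only [weight_cons, List.length_cons]
          omega)
      have h3 : Tendsto (fun d : ℕ => (d : ℂ)⁻¹) atTop (𝓝 0) :=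
        tendsto_inv_atTop_nhds_zero_nat
      have h4 := h1.add ((h3.pow 2).mul h2)
      rw [zero_pow two_ne_zero, zero_mul, add_zero] at h4
      refine h4.congr' ?_
      filter_upwards [eventually_ne_atTop 0] with d hd
      rw [expectation_traceProd_cons hd]

end LoopEquation

/-! ### From the Wishart matrix to words -/

section TraceMoment

open MvPolynomial ComplexConjugate

variable {d n m : ℕ}

/-- The matrix `m W^Γ`, with polynomial entries. -/
noncomputable def polyWishart (d n m : ℕ) :
    Matrix (Fin d × Fin n) (Fin d × Fin n) (MvPolynomial (Entry d n m × Bool) ℂ) :=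
  Matrix.of fun x y => ∑ c : Fin m, wordMatrix d [((y.2, c), false), ((x.2, c), true)] x.1 y.1

theorem polyWishart_pow_apply (p : ℕ) (x y : Fin d × Fin n) :
    (polyWishart d n m ^ p) x y = blockSum p x.2 y.2 fun w => wordMatrix d w x.1 y.1 := by
  induction p generalizing x with
  | zero =>
    obtain ⟨i, a⟩ := x
    obtain ⟨j, b⟩ := y
    rw [pow_zero, blockSum_zero_left, wordMatrix_nil]
    by_cases hi : i = j <;> by_cases ha : a = b <;> simp [Matrix.one_apply, hi, ha]
  | succ p ih =>
    have key : ∀ (e : Fin n) (c : Fin m),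
        (blockSum p e y.2 fun w => wordMatrix d (((e, c), false) :: ((x.2, c), true) :: w) x.1 y.1) =
        ∑ k, wordMatrix d [((e, c), false), ((x.2, c), true)] x.1 k *
          blockSum p e y.2 fun w => wordMatrix d w k y.1 := by
      intro e c
      have h : ∀ w, wordMatrix d (((e, c), false) :: ((x.2, c), true) :: w) x.1 y.1 =
          ∑ k, wordMatrix d [((e, c), false), ((x.2, c), true)] x.1 k * wordMatrix d w k y.1 := by
        intro w
        rw [← Matrix.mul_apply, ← wordMatrix_append]
        rfl
      simp only [h, blockSum_sum, blockSum_const_mul]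
    rw [pow_succ', Matrix.mul_apply, blockSum_succ, Fintype.sum_prod_type_right]
    refine Finset.sum_congr rfl fun e _ => ?_
    rw [Finset.sum_congr rfl fun c _ => key e c, Finset.sum_comm]
    refine Finset.sum_congr rfl fun k _ => ?_
    rw [ih, polyWishart, Matrix.of_apply, Finset.sum_mul]

/-- The polynomial in the entries of `G` and their conjugates that gives `tr ((m W^Γ)^p)`. -/
noncomputable def polyTraceMoment (d n m p : ℕ) : MvPolynomial (Entry d n m × Bool) ℂ :=
  C (n : ℂ)⁻¹ * ∑ a : Fin n, blockSum p a a (wordTrace d)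

/-- Partial transposition exchanges a and b, whence G_{bc} G_{ac}^* in block (a, b). The factor m
cancels the m^{-1} of `wishart`, and the two letter normalizations supply d^{-1}. -/
theorem mapMatrix_polyWishart (hm : 1 ≤ m) (G : Matrix (Fin d × Fin n) (Fin d × Fin m) ℂ) :
    (aeval (R := ℂ) (conjPoint fun k : Entry d n m => G k.1 k.2)).mapMatrix (polyWishart d n m) =
      (m : ℂ) • partialTranspose (wishart G) := by
  have hm' : (m : ℂ) ≠ 0 := by exact_mod_cast (by omega : m ≠ 0)
  ext ⟨i, a⟩ ⟨j, b⟩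
  simp only [AlgHom.mapMatrix_apply, Matrix.map_apply, polyWishart, Matrix.of_apply, map_sum,
    wordMatrix_cons, wordMatrix_nil, mul_one, Matrix.mul_apply, letterMatrix_apply, map_mul,
    Matrix.smul_apply, partialTranspose, wishart, Matrix.conjTranspose_apply, smul_eq_mul,
    Fintype.sum_prod_type, Finset.mul_sum]
  rw [Finset.sum_comm]
  refine Finset.sum_congr rfl fun k _ => Finset.sum_congr rfl fun c _ => ?_
  simp [entryVar, conjPoint]
  rw [mul_mul_mul_comm, scale_mul_scale]
  field_simp

theorem aeval_polyTraceMoment (hm : 1 ≤ m) (p : ℕ)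
    (G : Matrix (Fin d × Fin n) (Fin d × Fin m) ℂ) :
    aeval (conjPoint fun k : Entry d n m => G k.1 k.2) (polyTraceMoment d n m p) =
      traceMoment p G := by
  rw [traceMoment, ← mapMatrix_polyWishart hm, ← map_pow, normalizedTrace]
  have : (polyWishart d n m ^ p).trace = ∑ a, blockSum p a a fun w => (wordMatrix d w).trace := by
    rw [Matrix.trace, Fintype.sum_prod_type, Finset.sum_comm]
    simp only [Matrix.diag_apply, polyWishart_pow_apply]
    exact Finset.sum_congr rfl fun a _ => (blockSum_sum _ p a a _).symm
  rw [AlgHom.mapMatrix_apply, ← AddMonoidHom.map_trace, this, polyTraceMoment]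
  have h2 : ∀ a : Fin n, blockSum p a a (wordTrace (m := m) d) =
      C (d : ℂ)⁻¹ * blockSum p a a fun w => (wordMatrix d w).trace := fun a =>
    blockSum_const_mul _ p a a _
  simp only [h2, ← Finset.mul_sum, map_mul, aeval_C, mul_inv]
  rw [Algebra.algebraMap_self_apply, Algebra.algebraMap_self_apply]
  ring

variable {Ω : Type*} [MeasurableSpace Ω] {P : Measure Ω}
  {G : Ω → Matrix (Fin d × Fin n) (Fin d × Fin m) ℂ}

theorem HasIIDGaussianEntries.hasLaw_pi (hG : HasIIDGaussianEntries P G) :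
    HasLaw (fun ω (k : Entry d n m) => G ω k.1 k.2) (Measure.pi fun _ => stdComplexGaussian) P :=
  hG.indep.hasLaw_pi fun k => hG.law k.1 k.2

theorem HasIIDGaussianEntries.integrable_traceMoment (hG : HasIIDGaussianEntries P G) (hm : 1 ≤ m)
    (p : ℕ) : Integrable (fun ω => traceMoment p (G ω)) P := by
  have h := integrable_aeval_conjPoint (polyTraceMoment d n m p)
  rw [← hG.hasLaw_pi.map_eq] at h
  simpa only [Function.comp_def, aeval_polyTraceMoment hm] using
    h.comp_aemeasurable hG.hasLaw_pi.aemeasurable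

theorem HasIIDGaussianEntries.integral_traceMoment (hG : HasIIDGaussianEntries P G) (hm : 1 ≤ m)
    (p : ℕ) : ∫ ω, traceMoment p (G ω) ∂P =
      (n : ℂ)⁻¹ * ∑ a : Fin n, blockSum p a a fun w =>
        expectation (Entry d n m) (traceProd d [w]) := by
  have h := (integrable_aeval_conjPoint (polyTraceMoment d n m p)).aestronglyMeasurable
  have := hG.hasLaw_pi.integral_comp h
  simp only [Function.comp_def, aeval_polyTraceMoment hm] at this
  rw [this, ← expectation_apply, polyTraceMoment, ← smul_eq_C_mul, map_smul, map_sum, smul_eq_mul]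
  simp only [← blockSum_map, traceProd, List.map_singleton, List.prod_singleton]

end TraceMoment

end BlockWishart

theorem theorem2p1 (m n : ℕ) (hm : 1 ≤ m) (hn : 1 ≤ n)
    (Ω : ℕ → Type*) [∀ d, MeasurableSpace (Ω d)]
    (P : ∀ d, Measure (Ω d)) [∀ d, IsProbabilityMeasure (P d)]
    (G : ∀ d, Ω d → Matrix (Fin d × Fin n) (Fin d × Fin m) ℂ)
    (hG : ∀ d, BlockWishart.HasIIDGaussianEntries (P d) (G d)) :
    ∃ M : ℕ → ℝ,
      -- the limiting moments `M p = lim_{d → ∞} E tr ((m W^Γ)^p)` exist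
      (∀ p d, Integrable (fun ω => BlockWishart.traceMoment p (G d ω)) (P d)) ∧
      (∀ p, Tendsto (fun d => ∫ ω, BlockWishart.traceMoment p (G d ω) ∂(P d)) atTop
        (𝓝 (M p : ℂ))) ∧
      -- the equation, for `F = ∑ M p z ^ p` as a formal power series
      (∀ F : PowerSeries ℝ, F = PowerSeries.mk M →
        (F - 1) * (1 - PowerSeries.X ^ 2 * F ^ 2) =
          (m : PowerSeries ℝ) * PowerSeries.X * F * (1 + (n : PowerSeries ℝ) * PowerSeries.X * F)) ∧
      -- the equation, for `F` as a function, defined at least for `|z| < (4mn)⁻¹`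
      (∀ z : ℂ, ‖z‖ < (4 * (m : ℝ) * (n : ℝ))⁻¹ →
        ∃ F : ℂ, HasSum (fun p => (M p : ℂ) * z ^ p) F ∧
          (F - 1) * (1 - z ^ 2 * F ^ 2) = (m : ℂ) * z * F * (1 + (n : ℂ) * z * F)) := by
  obtain ⟨M, N, hT, h0, h1, hM, hN0, hN⟩ := BlockWishart.exists_moment_sequences m hn
  refine ⟨fun p => M p, fun p d => (hG d).integrable_traceMoment hm p, fun p => ?_,
    fun F hF => BlockWishart.powerSeries_equation ℝ h0 h1 hM hN0 hN hF, fun z hz => ?_⟩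
  · have hn' : (n : ℂ) ≠ 0 := by exact_mod_cast (by omega : n ≠ 0)
    simp only [fun d => (hG d).integral_traceMoment hm p]
    -- Every diagonal block has the same limit, so the average over the n blocks is that limit.
    have key : ∀ a : Fin n, (BlockWishart.blockSum p a a fun w : List (BlockWishart.Letter n m) =>
        (BlockWishart.freeMoment w : ℂ)) = M p := by
      intro a
      have h := hT p a a
      rw [if_pos rfl, BlockWishart.blockMoment] at h
      rw [← h]
      exact BlockWishart.blockSum_map (Nat.castAddMonoidHom ℂ) p a a
        (BlockWishart.freeMoment (E := Fin n × Fin m))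
    have lim := (tendsto_finsetSum (Finset.univ : Finset (Fin n)) fun a _ =>
      BlockWishart.tendsto_blockSum
        (fun w : List (BlockWishart.Letter n m) =>
          BlockWishart.tendsto_expectation_traceProd [w]) p a a).const_mul (n : ℂ)⁻¹
    simpa [key, hn'] using lim
  · simpa using BlockWishart.exists_hasSum_equation hm hn h0 h1 hM hN0 hN hz
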